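/- **Setting.** A transmitter $S$ and a receiver $D$ with batteries of infinite capacity operate in slots $t=0,1,2,\dots$. Fix constants $R,z,\alpha,P_D>0$ and $P_{C,S}\ge 0$, and put $c=(2^R-1)(1+\alpha)z$. In slot $t$ node $S$ uses a transmission power $P_{\rm tx}^t\ge 0$ and consumes $P_S^t=(1+\alpha)P_{\rm tx}^t+P_{C,S}\mathbf 1_{P_{\rm tx}^t>0}$; node $D$ is either active, consuming $P_D$, or inactive, consuming nothing. The harvested energies $(E_S^t)_t$ and $(E_D^t)_t$ are nonnegative, each sequence is stationary and ergodic, and their means are $\lambda_S>0$ and $\lambda_D>0$; their joint law is arbitrary. The batteries start from arbitrary finite nonnegative (possibly random) levels and evolve by $B_S^{t+1}=B_S^t-P_S^t+E_S^t$ and $B_D^{t+1}=B_D^t-P_D\mathbf 1_{D\text{ active in slot }t}+E_D^t$. The channel is block Rayleigh fading: the power gains $|h_t|^2$ are i.i.d. exponential with mean $1$ and independent of everything else. Each slot carries one packet, with no retransmission; it is received if and only if $P_{\rm tx}^t>0$, $D$ is active, and $|h_t|^2\ge (2^R-1)z/P_{\rm tx}^t$. Otherwise it is in outage. The decisions of $S$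 and $D$ are coordinated, so that each node knows whether the other transmits or receives. An admissible stationary policy is a time-invariant measurable rule giving $P_{\rm tx}^t$ and the activity of $D$ as a function of $(B_S^t,B_D^t)$ and of a randomization variable (i.i.d. uniform on $[0,1]$ over time, independent of the initial levels and of the harvested energies), subject to $P_S^t\le B_S^t$, and to $P_D\le B_D^t$ whenever $D$ is active. For a policy $\pi$ let $p_n(\pi)$ be the average over the first $n$ slots of the probability that the packet is in outage. The joint threshold policy with threshold $P_S>P_{C,S}$ lets $S$ transmit, with total consumption $P_S$ (that is, $P_{\rm tx}^t=(P_S-P_{C,S})/(1+\alpha)$), and lets $D$ be active, exactly in the slots in which $B_S^t\ge P_S$ and $B_D^t\ge P_D$; in all other slots both nodes are idle. **Theorem 3.** Let $$P_S^*=\max\Big(\lambda_S,\;B_{\rm th},\;\frac{\lambda_SP_D}{\lambda_D}\Big),\qquad B_{\rm th}=\tfrac12\Big[(2P_{C,S}+c)+c^{1/2}(4P_{C,S}+c)^{1/2}\Big].$$ Then $P_S^*>P_{C,S}$, and the joint threshold policy with threshold $P_S^*$ is an admissible stationary policy. Its long-run outage probability $\lim_n p_n$ exists and equals $$p^*=1-\exp\Big(-\frac{(1+\alpha)(2^R-1)z}{P_S^*-P_{C,S}}\Big)\min\Big(1,\frac{\lambda_S}{P_S^*},\frac{\lambda_D}{P_D}\Big),$$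 and it is optimal: $\liminf_n p_n(\pi)\ge p^*$ for every admissible stationary policy $\pi$. Moreover $P_S^*$ is the unique optimal threshold: for every $P_S>P_{C,S}$ with $P_S\neq P_S^*$, the joint threshold policy with threshold $P_S$ has a long-run outage probability, and it is strictly larger than $p^*$. All of this holds regardless of the correlation between the two energy-arrival processes; in particular $P_S^*$ and $p^*$ do not depend on it. -/

import Mathlib

open MeasureTheory ProbabilityTheory Filter Topology
open scoped ENNReal

namespace EHLink

noncomputable section

/-- The constants of the link: transmission rate `R`, noise power `z`, amplifier constant `α`,
static circuit power `PCS` of the transmitter `S`, and power `PD` that the receiver `D` consumes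
in a slot in which it is active. -/
structure Params where
  R : ℝ
  z : ℝ
  α : ℝ
  PCS : ℝ
  PD : ℝ
  R_pos : 0 < R
  z_pos : 0 < z
  α_pos : 0 < α
  PCS_nonneg : 0 ≤ PCS
  PD_pos : 0 < PD

/-- Power consumed by `S` when its transmission power is `x`. -/
def Params.consumption (L : Params) (x : ℝ) : ℝ :=
  (1 + L.α) * x + (if 0 < x then L.PCS else 0)

/-- Transmission power of `S` when its total power consumption is `p > PCS`. -/
def Params.txPower (L : Params) (p : ℝ) : ℝ := (p - L.PCS) / (1 + L.α)

/-- The constant `c = (2 ^ R - 1) (1 + α) z`. -/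
def Params.c (L : Params) : ℝ := ((2 : ℝ) ^ L.R - 1) * (1 + L.α) * L.z

/-- The power level `B_th`. -/
def Params.Bth (L : Params) : ℝ :=
  (1 / 2) * ((2 * L.PCS + L.c) + √L.c * √(4 * L.PCS + L.c))

/-- A time-invariant decision rule. Given the battery energies `bS`, `bD` of the two nodes and a
randomization variable `v`, `S` transmits with power `tx bS bD v` (it stays silent if this is `0`),
and `D` is active if and only if `rx bS bD v` holds. -/
structure Policy where
  tx : ℝ → ℝ → ℝ → ℝ
  rx : ℝ → ℝ → ℝ → Prop

/-- The decision rule is measurable, and no node ever spends energy that it does not have. -/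
structure Policy.IsAdmissible (L : Params) (π : Policy) : Prop where
  measurable_tx : Measurable fun x : ℝ × ℝ × ℝ => π.tx x.1 x.2.1 x.2.2
  measurable_rx : MeasurableSet {x : ℝ × ℝ × ℝ | π.rx x.1 x.2.1 x.2.2}
  tx_nonneg : ∀ bS bD v : ℝ, 0 ≤ bS → 0 ≤ bD → 0 ≤ π.tx bS bD v
  tx_feasible : ∀ bS bD v : ℝ, 0 ≤ bS → 0 ≤ bD → L.consumption (π.tx bS bD v) ≤ bS
  rx_feasible : ∀ bS bD v : ℝ, 0 ≤ bS → 0 ≤ bD → π.rx bS bD v → L.PD ≤ bD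

open Classical in
/-- The joint threshold policy with threshold `PS`: if both batteries suffice, `S` transmits with
total power consumption `PS` and `D` receives; otherwise both nodes stay idle. -/
def jointThreshold (L : Params) (PS : ℝ) : Policy where
  tx bS bD _ := if PS ≤ bS ∧ L.PD ≤ bD then L.txPower PS else 0
  rx bS bD _ := PS ≤ bS ∧ L.PD ≤ bD

/-- The law of the real-valued process `E` is stationary and ergodic: the shift of the sequence
space preserves it and is ergodic for it. -/
structure IsStationaryErgodic {Ω : Type*} [MeasurableSpace Ω] (μ : Measure Ω) (E : ℕ → Ω → ℝ) :
    Prop where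
  measurable : ∀ t, Measurable (E t)
  ergodic : Ergodic (fun (x : ℕ → ℝ) (t : ℕ) => x (t + 1)) (μ.map fun ω t => E t ω)

/-- The random quantities that drive the link: initial battery energies, energies harvested in each
slot, channel power gains `|h|²`, and randomization variables available to the policy. -/
structure Inputs (Ω : Type*) where
  B0S : Ω → ℝ
  B0D : Ω → ℝ
  ES : ℕ → Ω → ℝ
  ED : ℕ → Ω → ℝ
  gain : ℕ → Ω → ℝ
  seed : ℕ → Ω → ℝ

/-- The standing assumptions on the random inputs. The joint law of the two harvesting processes
(and of the initial battery energies) is otherwise arbitrary. -/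
structure Inputs.IsValid {Ω : Type*} [MeasurableSpace Ω] (I : Inputs Ω) (μ : Measure Ω)
    (lamS lamD : ℝ) : Prop where
  measurable_B0S : Measurable I.B0S
  measurable_B0D : Measurable I.B0D
  B0S_nonneg : ∀ ω, 0 ≤ I.B0S ω
  B0D_nonneg : ∀ ω, 0 ≤ I.B0D ω
  ES_nonneg : ∀ t ω, 0 ≤ I.ES t ω
  ED_nonneg : ∀ t ω, 0 ≤ I.ED t ω
  ES_ergodic : IsStationaryErgodic μ I.ES
  ED_ergodic : IsStationaryErgodic μ I.ED
  ES_integrable : ∀ t, Integrable (I.ES t) μ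
  ED_integrable : ∀ t, Integrable (I.ED t) μ
  ES_mean : ∀ t, ∫ ω, I.ES t ω ∂μ = lamS
  ED_mean : ∀ t, ∫ ω, I.ED t ω ∂μ = lamD
  /- Rayleigh block fading with mean power one: the power gains are i.i.d. exponential. -/
  measurable_gain : ∀ t, Measurable (I.gain t)
  gain_law : ∀ t, μ.map (I.gain t) = expMeasure 1
  gain_iIndep : iIndepFun I.gain μ
  /- The randomization variables are i.i.d. uniform on the unit interval. -/
  measurable_seed : ∀ t, Measurable (I.seed t)
  seed_law : ∀ t, μ.map (I.seed t) = volume.restrict (Set.Icc 0 1)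
  seed_iIndep : iIndepFun I.seed μ
  seed_indep : IndepFun (fun ω t => I.seed t ω)
    (fun ω => (I.B0S ω, I.B0D ω, (fun t => I.ES t ω), (fun t => I.ED t ω))) μ
  gain_indep : IndepFun (fun ω t => I.gain t ω)
    (fun ω => (I.B0S ω, I.B0D ω, (fun t => I.ES t ω), (fun t => I.ED t ω),
      (fun t => I.seed t ω))) μ

open Classical in
/-- The battery energies of `S` and `D` at the beginning of each slot, with infinite battery
capacity. -/
def battery {Ω : Type*} (L : Params) (I : Inputs Ω) (π : Policy) : ℕ → Ω → ℝ × ℝ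
  | 0, ω => (I.B0S ω, I.B0D ω)
  | t + 1, ω =>
    let b := battery L I π t ω
    (b.1 - L.consumption (π.tx b.1 b.2 (I.seed t ω)) + I.ES t ω,
      b.2 - (if π.rx b.1 b.2 (I.seed t ω) then L.PD else 0) + I.ED t ω)

/-- The packet sent in slot `t` is received: `S` transmits, `D` is active, and the channel is
not in outage. -/
def Success {Ω : Type*} (L : Params) (I : Inputs Ω) (π : Policy) (t : ℕ) (ω : Ω) : Prop :=
  let b := battery L I π t ω
  let x := π.tx b.1 b.2 (I.seed t ω)
  0 < x ∧ π.rx b.1 b.2 (I.seed t ω) ∧ ((2 : ℝ) ^ L.R - 1) * L.z / x ≤ I.gain t ω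

/-- The outage probability averaged over the first `n` slots, each slot carrying one packet that
is not retransmitted. -/
def avgOutage {Ω : Type*} [MeasurableSpace Ω] (L : Params) (I : Inputs Ω) (μ : Measure Ω)
    (π : Policy) (n : ℕ) : ℝ :=
  (1 / (n : ℝ)) * ∑ t ∈ Finset.range n, μ.real {ω | ¬ Success L I π t ω}

/-- `max (λ_S, B_th, λ_S P_D / λ_D)`. -/
def Params.optThreshold (L : Params) (lamS lamD : ℝ) : ℝ :=
  max lamS (max L.Bth (lamS * L.PD / lamD))

/-- The long-run outage probability
`1 - exp (- (2 ^ R - 1) z / P_tx) * min (1, λ_S / P_S, λ_D / P_D)`. -/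
def Params.thresholdOutage (L : Params) (lamS lamD PS : ℝ) : ℝ :=
  1 - Real.exp (-(((2 : ℝ) ^ L.R - 1) * L.z / L.txPower PS)) *
    min 1 (min (lamS / PS) (lamD / L.PD))

end

end EHLink

/-! The argument is linear programming duality. Let f(p) = exp(-c/(p - PCS)) be the success
probability of a slot in which `D` listens and `S` consumes p. The ray from the origin touches the
graph of f at `Bth`. From there on, the tangent u p + w at a point q has u, w ≥ 0, lies strictly
above f away from q, and has w = 0 at q = `Bth` (`Params.exists_tangent`).

Converse: each slot has conditional success probability at most u · (energy spent by `S`) + w ·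
1{`D` active}. Summed over slots, the first term is limited by the energy of `S`, the second by both
the number of slots and the energy of `D`. Hence the success frequency is asymptotically at most u
λ_S + w min(1, λ_D/P_D). With q the proposed threshold this equals f(q) λ_S/q by complementary
slackness (`Params.exists_dual`).

Achievability: under a threshold policy a slot is idle only if one battery is short, so along each
path the number of active slots follows the scarcer of the budgets n, n λ_S/P_S, n λ_D/P_D up to
sublinear error (`exists_le_activeCount`). This uses only almost sure linear lower bounds for the
two harvests separately (`IsStationaryErgodic.ae_exists_le_sum`), so their correlation plays no
role. Uniqueness of the threshold is the strictness of the tangent inequality. -/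

namespace EHLink

/-! ### The optimization over power levels -/

/-- Tangent inequality in the variable s = c/(p - PCS), divided by exp(-s₀). Invert 1 + x < exp x at
x = s - s₀; what remains is a rational inequality whose two sides differ by a multiple of (1 - s₀)(s
- s₀)², so s₀ ≤ 1 is what makes it hold. -/
theorem exp_sub_lt {s s₀ : ℝ} (h1 : s₀ ≤ 1) (hs : 0 < s) (hne : s ≠ s₀) :
    Real.exp (s₀ - s) < 1 + s₀ * (s₀ - s) / s := by
  have hd : s - s₀ ≠ 0 := sub_ne_zero.2 hne
  have h := Real.add_one_lt_exp hd
  have hE : Real.exp (s₀ - s) = (Real.exp (s - s₀))⁻¹ := by rw [← Real.exp_neg]; ring_nf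
  have hpos : 0 < s - s₀ + 1 := by linarith
  have h2 : (Real.exp (s - s₀))⁻¹ < (s - s₀ + 1)⁻¹ := inv_strictAnti₀ hpos h
  have h3 : (s - s₀ + 1)⁻¹ ≤ 1 + s₀ * (s₀ - s) / s := by
    rw [← sub_nonneg]
    have : 1 + s₀ * (s₀ - s) / s - (s - s₀ + 1)⁻¹
        = (1 - s₀) * (s - s₀) ^ 2 / (s * (s - s₀ + 1)) := by
      field_simp
      ring
    rw [this]
    have : 0 ≤ 1 - s₀ := by linarith
    positivity
  rw [hE]; linarith

theorem Params.c_pos (L : Params) : 0 < L.c := by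
  have h1 : (1 : ℝ) < 2 ^ L.R := Real.one_lt_rpow (by norm_num) L.R_pos
  have := L.z_pos
  have := L.α_pos
  unfold Params.c
  have : 0 < (2 : ℝ) ^ L.R - 1 := by linarith
  positivity

theorem Params.outage_pos (L : Params) : 0 < ((2 : ℝ) ^ L.R - 1) * L.z := by
  have h1 : (1 : ℝ) < 2 ^ L.R := Real.one_lt_rpow (by norm_num) L.R_pos
  exact mul_pos (by linarith) L.z_pos

theorem Params.txPower_pos (L : Params) {p : ℝ} (hp : L.PCS < p) : 0 < L.txPower p := by
  have := L.α_pos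
  unfold Params.txPower
  exact div_pos (by linarith) (by linarith)

theorem Params.consumption_txPower (L : Params) {p : ℝ} (hp : L.PCS < p) :
    L.consumption (L.txPower p) = p := by
  have := L.α_pos
  rw [Params.consumption, if_pos (L.txPower_pos hp), Params.txPower]
  field_simp
  ring

theorem Params.outage_div_txPower (L : Params) (p : ℝ) :
    ((2 : ℝ) ^ L.R - 1) * L.z / L.txPower p = L.c / (p - L.PCS) := by
  have := L.α_pos
  unfold Params.txPower Params.c
  rw [div_div_eq_mul_div]
  ring

/-- `Bth` is the larger root of (p - PCS)² = c p, which is the tangency condition p f'(p) = f(p) for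
a ray from the origin. The lower bound ensures c/(q - PCS) ≤ 1 for q ≥ `Bth`, as `exp_sub_lt`
requires. -/
theorem Params.Bth_sub (L : Params) :
    L.PCS + L.c ≤ L.Bth ∧ (L.Bth - L.PCS) ^ 2 = L.c * L.Bth := by
  have hc := L.c_pos
  have hP := L.PCS_nonneg
  have h1 := Real.mul_self_sqrt hc.le
  have h2 := Real.mul_self_sqrt (show 0 ≤ 4 * L.PCS + L.c by linarith)
  have h3 : √L.c ≤ √(4 * L.PCS + L.c) := Real.sqrt_le_sqrt (by linarith)
  have h4 := Real.sqrt_nonneg L.c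
  unfold Params.Bth
  set a := √L.c
  set b := √(4 * L.PCS + L.c)
  constructor
  · nlinarith
  · have h5 : (a * b) ^ 2 = L.c * (4 * L.PCS + L.c) := by
      calc (a * b) ^ 2 = (a * a) * (b * b) := by ring
        _ = _ := by rw [h1, h2]
    nlinarith

/-- The power-to-success curve lies below its tangent at any point beyond `B_th`, which has
nonnegative intercept. -/
theorem Params.exists_tangent (L : Params) {q : ℝ} (hq : L.Bth ≤ q) :
    ∃ u w : ℝ, 0 ≤ u ∧ 0 ≤ w ∧ (q = L.Bth → w = 0) ∧
      Real.exp (-(L.c / (q - L.PCS))) = u * q + w ∧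
      ∀ p, L.PCS < p → p ≠ q → Real.exp (-(L.c / (p - L.PCS))) < u * p + w := by
  obtain ⟨hB1, hB2⟩ := L.Bth_sub
  have hc := L.c_pos
  have hP := L.PCS_nonneg
  have hx : 0 < q - L.PCS := by linarith
  have hg := Real.exp_pos (-(L.c / (q - L.PCS)))
  set g := Real.exp (-(L.c / (q - L.PCS))) with hgdef
  -- Slope f'(q) and intercept f(q) - q f'(q). The intercept has the sign of (q - PCS)² - c q, hence
  -- is nonnegative from `Bth` on.
  refine ⟨g * (L.c / (q - L.PCS) ^ 2), g * (1 - q * (L.c / (q - L.PCS) ^ 2)), by positivity,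
    ?_, ?_, by ring, ?_⟩
  · refine mul_nonneg hg.le ?_
    rw [sub_nonneg, mul_div_assoc', div_le_one (by positivity)]
    nlinarith
  · rintro rfl
    rw [hB2]
    have : L.Bth ≠ 0 := by linarith
    field_simp
    ring
  · intro p hp hne
    have hy : 0 < p - L.PCS := by linarith
    have key := exp_sub_lt (s := L.c / (p - L.PCS)) (s₀ := L.c / (q - L.PCS))
      (by rw [div_le_one hx]; linarith) (by positivity) (by
        intro h
        rw [div_eq_div_iff hy.ne' hx.ne'] at h
        have := mul_left_cancel₀ hc.ne' h
        exact hne (by linarith))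
    have e : Real.exp (-(L.c / (p - L.PCS)))
        = g * Real.exp (L.c / (q - L.PCS) - L.c / (p - L.PCS)) := by
      rw [hgdef, ← Real.exp_add]; ring_nf
    rw [e]
    calc _ < g * (1 + L.c / (q - L.PCS) * (L.c / (q - L.PCS) - L.c / (p - L.PCS))
          / (L.c / (p - L.PCS))) := mul_lt_mul_of_pos_left key hg
      _ = _ := by
        field_simp
        ring

theorem Params.PCS_lt_Bth (L : Params) : L.PCS < L.Bth := by
  have := L.Bth_sub.1
  have := L.c_pos
  linarith

theorem Params.PCS_lt_optThreshold (L : Params) (lamS lamD : ℝ) :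
    L.PCS < L.optThreshold lamS lamD :=
  L.PCS_lt_Bth.trans_le ((le_max_left _ _).trans (le_max_right _ _))

/-- The tangent at the optimal threshold is an optimal dual pair: the last conjunct says that there
is no duality gap. -/
theorem Params.exists_dual (L : Params) {lamS lamD : ℝ} (hS : 0 < lamS) (hD : 0 < lamD) :
    ∃ u w : ℝ, 0 ≤ u ∧ 0 ≤ w ∧
      (∀ p, L.PCS < p → Real.exp (-(L.c / (p - L.PCS))) ≤ u * p + w) ∧
      (∀ p, L.PCS < p → p ≠ L.optThreshold lamS lamD →
        Real.exp (-(L.c / (p - L.PCS))) < u * p + w) ∧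
      L.thresholdOutage lamS lamD (L.optThreshold lamS lamD)
        = 1 - (u * lamS + w * min 1 (lamD / L.PD)) := by
  have hPD := L.PD_pos
  have h1 : lamS ≤ L.optThreshold lamS lamD := le_max_left _ _
  have h2 : L.Bth ≤ L.optThreshold lamS lamD := (le_max_left _ _).trans (le_max_right _ _)
  have h3 : lamS * L.PD / lamD ≤ L.optThreshold lamS lamD :=
    (le_max_right _ _).trans (le_max_right _ _)
  have h4 : L.optThreshold lamS lamD = L.Bth ∨ L.optThreshold lamS lamD = lamS ∨
      L.optThreshold lamS lamD = lamS * L.PD / lamD := by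
    unfold Params.optThreshold
    rcases max_choice lamS (max L.Bth (lamS * L.PD / lamD)) with h | h
    · exact Or.inr (Or.inl h)
    · rw [h]
      rcases max_choice L.Bth (lamS * L.PD / lamD) with h | h
      · exact Or.inl h
      · exact Or.inr (Or.inr h)
  obtain ⟨u, w, hu, hw, hw0, he, hlt⟩ := L.exists_tangent h2
  unfold Params.thresholdOutage
  set q := L.optThreshold lamS lamD
  have hq : 0 < q := hS.trans_le h1
  refine ⟨u, w, hu, hw, ?_, hlt, ?_⟩
  · intro p hp
    rcases eq_or_ne p q with rfl | hne
    · exact he.le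
    · exact (hlt p hp hne).le
  · have a1 : lamS / q ≤ 1 := (div_le_one hq).2 h1
    have a2 : lamS / q ≤ lamD / L.PD := by
      rw [div_le_iff₀ hD] at h3
      rw [div_le_div_iff₀ hq hPD]
      linarith
    rw [min_eq_left a2, min_eq_right a1, L.outage_div_txPower, he]
    -- Complementary slackness, according to the term attaining the maximum: at `Bth` the intercept
    -- w vanishes; at λ_S both sides have factor 1; at λ_S P_D/λ_D both budgets run out at the same
    -- rate.
    have : w * min 1 (lamD / L.PD) = w * (lamS / q) := by
      rcases h4 with h | h | h
      · rw [hw0 h]; ring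
      · rw [h, div_self hS.ne'] at a2 ⊢
        rw [min_eq_left a2]
      · have e : lamS / q = lamD / L.PD := by
          rw [h]; field_simp
        rw [e] at a1 ⊢
        rw [min_eq_right a1]
    rw [this]
    field_simp

/-! ### Ergodic lower bound for partial sums -/

section Ergodic

variable {X : Type*}

/-- The maximum of `0` and of the first `n` Birkhoff sums. -/
noncomputable def birkhoffMax (T : X → X) (g : X → ℝ) : ℕ → X → ℝ
  | 0, _ => 0
  | n + 1, x => max 0 (g x + birkhoffMax T g n (T x))

variable {T : X → X} {g : X → ℝ}

theorem birkhoffMax_nonneg (n : ℕ) (x : X) : 0 ≤ birkhoffMax T g n x := by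
  cases n with
  | zero => exact le_rfl
  | succ n => exact le_max_left _ _

theorem birkhoffMax_le_succ (n : ℕ) (x : X) : birkhoffMax T g n x ≤ birkhoffMax T g (n + 1) x := by
  induction n generalizing x with
  | zero => exact birkhoffMax_nonneg _ _
  | succ n ih => exact max_le_max le_rfl (by linarith [ih (T x)])

theorem birkhoffMax_mono (x : X) : Monotone fun n => birkhoffMax T g n x :=
  monotone_nat_of_le_succ fun n => birkhoffMax_le_succ n x

theorem birkhoffSum_le_birkhoffMax (n : ℕ) (x : X) : birkhoffSum T g n x ≤ birkhoffMax T g n x := by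
  induction n generalizing x with
  | zero => simp [birkhoffMax]
  | succ n ih =>
    rw [birkhoffSum_succ']
    exact le_max_of_le_right (by linarith [ih (T x)])

/-- This increment is dominated by |g|, and equals g x as soon as the maximum at T x exceeds |g x|.
Its integral is nonnegative when T preserves the measure. -/
theorem birkhoffMax_succ_sub (n : ℕ) (x : X) :
    birkhoffMax T g (n + 1) x - birkhoffMax T g n (T x) = max (-birkhoffMax T g n (T x)) (g x) := by
  rw [birkhoffMax, ← max_sub_sub_right]
  congr 1 <;> ring

variable [MeasurableSpace X] {ν : Measure X}

theorem measurable_birkhoffMax (hT : Measurable T) (hg : Measurable g) (n : ℕ) :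
    Measurable (birkhoffMax T g n) := by
  induction n with
  | zero => exact measurable_const
  | succ n ih => exact measurable_const.max (hg.add (ih.comp hT))

theorem integrable_birkhoffMax (hT : MeasurePreserving T ν ν) (hg : Integrable g ν) (n : ℕ) :
    Integrable (birkhoffMax T g n) ν := by
  induction n with
  | zero => exact integrable_zero _ _ _
  | succ n ih =>
    have h : Integrable (fun x => g x + birkhoffMax T g n (T x)) ν :=
      hg.add (hT.integrable_comp_of_integrable ih)
    simpa [birkhoffMax, max_comm] using h.pos_part

/-- The Birkhoff sums of a function with negative mean are almost everywhere bounded above. -/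
theorem ae_birkhoffSum_le [IsProbabilityMeasure ν] (hT : Ergodic T ν) (hgm : Measurable g)
    (hg : Integrable g ν) (hneg : ∫ x, g x ∂ν < 0) :
    ∀ᵐ x ∂ν, ∃ C : ℝ, ∀ n, birkhoffSum T g n x ≤ C := by
  have hTm := hT.toMeasurePreserving
  set E : Set X := {x | ∀ C : ℕ, ∃ n, (C : ℝ) < birkhoffMax T g n x} with hE
  have hEm : MeasurableSet E := by
    simp only [hE, Set.ofPred_forall, Set.ofPred_exists]
    exact MeasurableSet.iInter fun C => MeasurableSet.iUnion fun n =>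
      measurableSet_lt measurable_const (measurable_birkhoffMax hTm.measurable hgm n)
  -- By the recursion, the maxima at x and at T x differ by at most |g x| up to a shift of n, so
  -- they are unbounded together.
  have hinv : T ⁻¹' E = E := by
    ext x
    simp only [hE, Set.mem_preimage, Set.mem_ofPred_eq]
    constructor
    · intro h C
      obtain ⟨D, hD⟩ := exists_nat_ge ((C : ℝ) + |g x|)
      obtain ⟨n, hn⟩ := h D
      refine ⟨n + 1, lt_max_of_lt_right ?_⟩
      linarith [neg_abs_le (g x)]
    · intro h C
      obtain ⟨D, hD⟩ := exists_nat_ge ((C : ℝ) + |g x|)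
      obtain ⟨n, hn⟩ := h D
      have hn' := hn.trans_le (birkhoffMax_le_succ n x)
      have hC : (0 : ℝ) ≤ C := C.cast_nonneg
      refine ⟨n, ?_⟩
      rw [birkhoffMax, lt_max_iff] at hn'
      rcases hn' with h' | h'
      · linarith [abs_nonneg (g x)]
      · linarith [le_abs_self (g x)]
  rcases hT.toPreErgodic.ae_mem_or_ae_notMem hEm hinv with h | h
  · exfalso
    -- If the maxima were unbounded almost everywhere, the increments would converge to g under
    -- domination; their integrals are nonnegative, contradicting the negative mean.
    have hlim : Tendsto (fun n => ∫ x, max (-birkhoffMax T g n (T x)) (g x) ∂ν) atTop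
        (𝓝 (∫ x, g x ∂ν)) := by
      refine tendsto_integral_of_dominated_convergence (fun x => |g x|) (fun n => ?_) hg.abs
        (fun n => ae_of_all _ fun x => ?_) ?_
      · exact (((measurable_birkhoffMax hTm.measurable hgm n).comp hTm.measurable).neg.max
          hgm).aestronglyMeasurable
      · rw [Real.norm_eq_abs, abs_le]
        exact ⟨(neg_abs_le _).trans (le_max_right _ _),
          max_le (by linarith [birkhoffMax_nonneg (T := T) (g := g) n (T x), abs_nonneg (g x)])
            (le_abs_self _)⟩
      · filter_upwards [h] with x hx
        rw [← hinv] at hx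
        obtain ⟨D, hD⟩ := exists_nat_ge |g x|
        obtain ⟨N, hN⟩ := hx D
        refine tendsto_const_nhds.congr' ?_
        filter_upwards [eventually_ge_atTop N] with n hn
        have := birkhoffMax_mono (T := T) (g := g) (T x) hn
        simp only at this
        rw [max_eq_right]
        linarith [neg_abs_le (g x)]
    refine hneg.not_ge (ge_of_tendsto' hlim fun n => ?_)
    have hi := integrable_birkhoffMax hTm hg
    have hc : Integrable (fun x => birkhoffMax T g n (T x)) ν :=
      hTm.integrable_comp_of_integrable (hi n)
    have e : ∫ x, birkhoffMax T g n (T x) ∂ν = ∫ x, birkhoffMax T g n x ∂ν := by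
      rw [← integral_map hTm.aemeasurable
        (measurable_birkhoffMax hTm.measurable hgm n).aestronglyMeasurable, hTm.map_eq]
    calc (0 : ℝ) ≤ ∫ x, birkhoffMax T g (n + 1) x ∂ν - ∫ x, birkhoffMax T g n (T x) ∂ν := by
          rw [e, sub_nonneg]
          exact integral_mono (hi n) (hi (n + 1)) (birkhoffMax_le_succ n)
      _ = _ := by
          rw [← integral_sub (hi (n + 1)) hc]
          exact integral_congr_ae (ae_of_all _ fun x => birkhoffMax_succ_sub n x)
  · filter_upwards [h] with x hx
    simp only [hE, Set.mem_ofPred_eq, not_forall, not_exists, not_lt] at hx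
    obtain ⟨C, hC⟩ := hx
    exact ⟨C, fun n => (birkhoffSum_le_birkhoffMax n x).trans (hC n)⟩

end Ergodic

/-- Apply `ae_birkhoffSum_le` to a - x 0 on sequence space. This one-sided bound with a random
constant replaces the full ergodic theorem. -/
theorem IsStationaryErgodic.ae_exists_le_sum {Ω : Type*} [MeasurableSpace Ω] {μ : Measure Ω}
    [IsProbabilityMeasure μ] {E : ℕ → Ω → ℝ} (hE : IsStationaryErgodic μ E)
    (hint : Integrable (E 0) μ) {a : ℝ} (ha : a < ∫ ω, E 0 ω ∂μ) :
    ∀ᵐ ω ∂μ, ∃ C : ℝ, ∀ n : ℕ, a * n - C ≤ ∑ t ∈ Finset.range n, E t ω := by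
  have hmeas : Measurable fun ω t => E t ω := measurable_pi_lambda _ hE.measurable
  have hprob : IsProbabilityMeasure (μ.map fun ω t => E t ω) :=
    Measure.isProbabilityMeasure_map hmeas.aemeasurable
  have h0 : Measurable fun x : ℕ → ℝ => x 0 := measurable_pi_apply 0
  have hi : Integrable (fun x : ℕ → ℝ => x 0) (μ.map fun ω t => E t ω) :=
    (integrable_map_measure h0.aestronglyMeasurable hmeas.aemeasurable).2 hint
  have hmean : ∫ x, x 0 ∂(μ.map fun ω t => E t ω) = ∫ ω, E 0 ω ∂μ :=
    integral_map hmeas.aemeasurable h0.aestronglyMeasurable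
  have key := ae_birkhoffSum_le (g := fun x : ℕ → ℝ => a - x 0) hE.ergodic
    (measurable_const.sub h0) ((integrable_const a).sub hi) (by
      rw [integral_sub (integrable_const a) hi, hmean]
      simpa using ha)
  filter_upwards [ae_of_ae_map hmeas.aemeasurable key] with ω hω
  obtain ⟨C, hC⟩ := hω
  refine ⟨C, fun n => ?_⟩
  have hs : ∀ (k : ℕ) (x : ℕ → ℝ) (t : ℕ), ((fun (x : ℕ → ℝ) (t : ℕ) => x (t + 1))^[k] x) t
      = x (t + k) := by
    intro k
    induction k with
    | zero => intro x t; rfl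
    | succ k ih => intro x t; rw [Function.iterate_succ_apply, ih]; ring_nf
  have h := hC n
  simp only [birkhoffSum, hs, Finset.sum_sub_distrib, Finset.sum_const, Finset.card_range,
    nsmul_eq_mul, zero_add] at h
  linarith

/-- A counter that increases by one whenever it is below a line of slope at most one stays close
to that line. -/
theorem le_counter {N : ℕ → ℝ} {r K : ℝ} (hr : r ≤ 1) (hK : 0 ≤ K) (h0 : N 0 = 0)
    (hN : ∀ t : ℕ, N (t + 1) = N t + 1 ∨ (N (t + 1) = N t ∧ r * t - K ≤ N t)) (t : ℕ) :
    r * t - (K + 1) ≤ N t := by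
  induction t with
  | zero => rw [h0]; push_cast; linarith
  | succ t ih =>
    push_cast
    -- A jump gains 1, at least the slope r; a stall starts at most K below the line, which then
    -- rises by r ≤ 1. Hence the slack K + 1.
    rcases hN t with h | ⟨h, h'⟩ <;> rw [h] <;> linarith

/-! ### Battery dynamics -/

section Battery

variable {Ω : Type*} {L : Params} {I : Inputs Ω} {π : Policy}

theorem Params.consumption_nonneg (L : Params) {x : ℝ} (hx : 0 ≤ x) : 0 ≤ L.consumption x := by
  have := L.α_pos
  have := L.PCS_nonneg
  unfold Params.consumption
  split_ifs <;> positivity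

theorem battery_nonneg (hπ : π.IsAdmissible L) (h0S : ∀ ω, 0 ≤ I.B0S ω) (h0D : ∀ ω, 0 ≤ I.B0D ω)
    (hES : ∀ t ω, 0 ≤ I.ES t ω) (hED : ∀ t ω, 0 ≤ I.ED t ω) (t : ℕ) (ω : Ω) :
    0 ≤ (battery L I π t ω).1 ∧ 0 ≤ (battery L I π t ω).2 := by
  induction t with
  | zero => exact ⟨h0S ω, h0D ω⟩
  | succ t ih =>
    have h1 := hπ.tx_feasible _ _ (I.seed t ω) ih.1 ih.2
    have h2 := hπ.rx_feasible _ _ (I.seed t ω) ih.1 ih.2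
    refine ⟨?_, ?_⟩
    · simp only [battery]
      linarith [hES t ω]
    · simp only [battery]
      split_ifs with h
      · linarith [hED t ω, h2 h]
      · linarith [hED t ω, ih.2]

/-- The transmission power used in slot `t`. -/
noncomputable def txAt (L : Params) (I : Inputs Ω) (π : Policy) (t : ℕ) (ω : Ω) : ℝ :=
  π.tx (battery L I π t ω).1 (battery L I π t ω).2 (I.seed t ω)

/-- The receiver is active in slot `t`. -/
def RxAt (L : Params) (I : Inputs Ω) (π : Policy) (t : ℕ) (ω : Ω) : Prop :=
  π.rx (battery L I π t ω).1 (battery L I π t ω).2 (I.seed t ω)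

theorem battery_fst_eq (n : ℕ) (ω : Ω) : (battery L I π n ω).1 = I.B0S ω +
    ∑ t ∈ Finset.range n, I.ES t ω - ∑ t ∈ Finset.range n, L.consumption (txAt L I π t ω) := by
  induction n with
  | zero => simp [battery]
  | succ n ih =>
    rw [Finset.sum_range_succ, Finset.sum_range_succ, battery, txAt]
    simp only
    rw [ih]
    ring

open Classical in
theorem battery_snd_eq (n : ℕ) (ω : Ω) : (battery L I π n ω).2 = I.B0D ω +
    ∑ t ∈ Finset.range n, I.ED t ω -
      L.PD * ∑ t ∈ Finset.range n, (if RxAt L I π t ω then 1 else 0) := by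
  induction n with
  | zero => simp [battery]
  | succ n ih =>
    rw [Finset.sum_range_succ, Finset.sum_range_succ, battery]
    by_cases h : RxAt L I π n ω
    · rw [if_pos h, if_pos (show π.rx _ _ _ from h), ih]
      ring
    · rw [if_neg h, if_neg (show ¬ π.rx _ _ _ from h), ih]
      ring

theorem measurable_consumption (L : Params) : Measurable L.consumption := by
  unfold Params.consumption
  exact (measurable_const.mul measurable_id).add
    (Measurable.ite (measurableSet_lt measurable_const measurable_id) measurable_const
      measurable_const)

variable [MeasurableSpace Ω]

theorem measurable_battery (hπ : π.IsAdmissible L) (h0S : Measurable I.B0S)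
    (h0D : Measurable I.B0D) (hES : ∀ t, Measurable (I.ES t)) (hED : ∀ t, Measurable (I.ED t))
    (hseed : ∀ t, Measurable (I.seed t)) (t : ℕ) : Measurable (battery L I π t) := by
  classical
  induction t with
  | zero => exact h0S.prodMk h0D
  | succ t ih =>
    have htri : Measurable fun ω =>
        ((battery L I π t ω).1, (battery L I π t ω).2, I.seed t ω) :=
      ih.fst.prodMk (ih.snd.prodMk (hseed t))
    refine Measurable.prodMk ?_ ?_
    · exact (ih.fst.sub ((measurable_consumption L).comp (hπ.measurable_tx.comp htri))).add (hES t)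
    · exact (ih.snd.sub (Measurable.ite (htri hπ.measurable_rx) measurable_const
        measurable_const)).add (hED t)

theorem measurable_txAt (hπ : π.IsAdmissible L) (h0S : Measurable I.B0S)
    (h0D : Measurable I.B0D) (hES : ∀ t, Measurable (I.ES t)) (hED : ∀ t, Measurable (I.ED t))
    (hseed : ∀ t, Measurable (I.seed t)) (t : ℕ) : Measurable (txAt L I π t) :=
  have hb := measurable_battery hπ h0S h0D hES hED hseed t
  hπ.measurable_tx.comp (hb.fst.prodMk (hb.snd.prodMk (hseed t)))

theorem measurableSet_rxAt (hπ : π.IsAdmissible L) (h0S : Measurable I.B0S)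
    (h0D : Measurable I.B0D) (hES : ∀ t, Measurable (I.ES t)) (hED : ∀ t, Measurable (I.ED t))
    (hseed : ∀ t, Measurable (I.seed t)) (t : ℕ) : MeasurableSet {ω | RxAt L I π t ω} :=
  have hb := measurable_battery hπ h0S h0D hES hED hseed t
  (hb.fst.prodMk (hb.snd.prodMk (hseed t))) hπ.measurable_rx

end Battery

/-! ### Success probabilities -/

/-- Everything that the batteries depend on: initial levels, harvested energies and seeds. -/
abbrev Env : Type := ℝ × ℝ × (ℕ → ℝ) × (ℕ → ℝ) × (ℕ → ℝ)

/-- The inputs as functions of the environment. -/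
def envInputs : Inputs Env where
  B0S e := e.1
  B0D e := e.2.1
  ES t e := e.2.2.1 t
  ED t e := e.2.2.2.1 t
  -- A dummy value: the battery recursion never reads the gains.
  gain _ _ := 0
  seed t e := e.2.2.2.2 t

/-- The environment seen at a sample point. -/
def Inputs.env {Ω : Type*} (I : Inputs Ω) (ω : Ω) : Env :=
  (I.B0S ω, I.B0D ω, (fun t => I.ES t ω), (fun t => I.ED t ω), (fun t => I.seed t ω))

/-- The batteries, and so all decisions, factor through the environment, which is independent of the
fading. This allows integrating out the gain of each slot. -/
theorem battery_eq_env {Ω : Type*} {L : Params} (I : Inputs Ω) {π : Policy} (t : ℕ) (ω : Ω) :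
    battery L I π t ω = battery L envInputs π t (I.env ω) := by
  induction t with
  | zero => rfl
  | succ t ih =>
    simp only [battery]
    rw [ih]
    rfl

theorem txAt_eq_env {Ω : Type*} {L : Params} (I : Inputs Ω) {π : Policy} (t : ℕ) (ω : Ω) :
    txAt L I π t ω = txAt L envInputs π t (I.env ω) := by
  unfold txAt
  rw [battery_eq_env]
  rfl

theorem rxAt_iff_env {Ω : Type*} {L : Params} (I : Inputs Ω) {π : Policy} (t : ℕ) (ω : Ω) :
    RxAt L I π t ω ↔ RxAt L envInputs π t (I.env ω) := by
  unfold RxAt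
  rw [battery_eq_env]
  rfl

section EnvMeasurable

variable {L : Params} {π : Policy}

theorem measurable_txAt_env (hπ : π.IsAdmissible L) (t : ℕ) :
    Measurable (txAt L envInputs π t) :=
  measurable_txAt hπ (by unfold envInputs; fun_prop) (by unfold envInputs; fun_prop)
    (by intro t; unfold envInputs; fun_prop) (by intro t; unfold envInputs; fun_prop)
    (by intro t; unfold envInputs; fun_prop) t

theorem measurableSet_rxAt_env (hπ : π.IsAdmissible L) (t : ℕ) :
    MeasurableSet {e | RxAt L envInputs π t e} :=
  measurableSet_rxAt hπ (by unfold envInputs; fun_prop) (by unfold envInputs; fun_prop)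
    (by intro t; unfold envInputs; fun_prop) (by intro t; unfold envInputs; fun_prop)
    (by intro t; unfold envInputs; fun_prop) t

end EnvMeasurable

theorem expMeasure_Ici {a : ℝ} (ha : 0 ≤ a) :
    expMeasure 1 (Set.Ici a) = ENNReal.ofReal (Real.exp (-a)) := by
  have := isProbabilityMeasure_expMeasure (r := 1) one_pos
  have hat : expMeasure 1 {a} = 0 := by
    unfold expMeasure gammaMeasure
    exact withDensity_absolutelyContinuous _ _ (by simp)
  have h := cdf_expMeasure_eq (r := 1) one_pos a
  rw [cdf_eq_real, if_pos ha] at h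
  have h1 : (expMeasure 1).real (Set.Ioi a) = Real.exp (-a) := by
    rw [← Set.compl_Iic, measureReal_compl measurableSet_Iic, h]
    simp
  rw [← Set.Ioi_insert, Set.insert_eq, Set.union_comm, measure_union (by simp) (measurableSet_singleton a), hat, add_zero, ← h1,
    ofReal_measureReal]

/-- Conditioning on an environment independent of an exponential random variable. -/
theorem measureReal_exp_ge {Ω β : Type*} [MeasurableSpace Ω] [MeasurableSpace β] {μ : Measure Ω}
    [IsProbabilityMeasure μ] {G : Ω → ℝ} {W : Ω → β} (hG : Measurable G) (hW : Measurable W)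
    (hlaw : μ.map G = expMeasure 1) (hind : IndepFun G W μ) {s : Set β} (hs : MeasurableSet s)
    {y : β → ℝ} (hy : Measurable y) (hy0 : ∀ w ∈ s, 0 ≤ y w) :
    μ.real {ω | W ω ∈ s ∧ y (W ω) ≤ G ω}
      = ∫ ω, s.indicator (fun w => Real.exp (-y w)) (W ω) ∂μ := by
  have hprod := (indepFun_iff_map_prod_eq_prod_map_map hG.aemeasurable hW.aemeasurable).1 hind
  have := isProbabilityMeasure_expMeasure (r := 1) one_pos
  have := Measure.isProbabilityMeasure_map (μ := μ) hW.aemeasurable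
  have hD : MeasurableSet {p : ℝ × β | p.2 ∈ s ∧ y p.2 ≤ p.1} :=
    (measurable_snd hs).inter (measurableSet_le (hy.comp measurable_snd) measurable_fst)
  have hind_meas : Measurable (s.indicator fun w => Real.exp (-y w)) :=
    (Real.measurable_exp.comp hy.neg).indicator hs
  have hnn : ∀ w, 0 ≤ s.indicator (fun w => Real.exp (-y w)) w := fun w =>
    Set.indicator_nonneg (fun _ _ => (Real.exp_pos _).le) w
  rw [integral_eq_lintegral_of_nonneg_ae (ae_of_all _ fun ω => hnn _)
    (hind_meas.comp hW).aestronglyMeasurable, Measure.real]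
  congr 1
  have e : {ω | W ω ∈ s ∧ y (W ω) ≤ G ω}
      = (fun ω => (G ω, W ω)) ⁻¹' {p : ℝ × β | p.2 ∈ s ∧ y p.2 ≤ p.1} := rfl
  rw [e, ← Measure.map_apply (hG.prodMk hW) hD, hprod, hlaw, Measure.prod_apply_symm hD,
    lintegral_map (measurable_measure_prodMk_right hD) hW]
  refine lintegral_congr fun ω => ?_
  by_cases hw : W ω ∈ s
  · rw [Set.indicator_of_mem hw, ← expMeasure_Ici (hy0 _ hw)]
    congr 1
    ext x
    simp [hw]
  · rw [Set.indicator_of_notMem hw]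
    simp [hw]

open Classical in
/-- The probability that the packet of slot `t` is received, given everything but the fading. -/
noncomputable def successRate {Ω : Type*} (L : Params) (I : Inputs Ω) (π : Policy) (t : ℕ)
    (ω : Ω) : ℝ :=
  if 0 < txAt L I π t ω ∧ RxAt L I π t ω then
    Real.exp (-(((2 : ℝ) ^ L.R - 1) * L.z / txAt L I π t ω)) else 0

section Rate

variable {Ω : Type*} {L : Params} {I : Inputs Ω} {π : Policy}

theorem successRate_nonneg (t : ℕ) (ω : Ω) : 0 ≤ successRate L I π t ω := by
  unfold successRate
  split_ifs
  · exact (Real.exp_pos _).le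
  · exact le_rfl

theorem successRate_le_one (t : ℕ) (ω : Ω) : successRate L I π t ω ≤ 1 := by
  unfold successRate
  split_ifs with h
  · rw [Real.exp_le_one_iff, neg_nonpos]
    exact div_nonneg L.outage_pos.le h.1.le
  · exact zero_le_one

theorem successRate_eq_indicator (t : ℕ) (ω : Ω) : successRate L I π t ω =
    {e | 0 < txAt L envInputs π t e ∧ RxAt L envInputs π t e}.indicator
      (fun e => Real.exp (-(((2 : ℝ) ^ L.R - 1) * L.z / txAt L envInputs π t e))) (I.env ω) := by
  classical
  simp only [Set.indicator_apply, Set.mem_ofPred_eq, successRate, txAt_eq_env I, rxAt_iff_env I]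

variable [MeasurableSpace Ω] {μ : Measure Ω} {lamS lamD : ℝ}

theorem Inputs.IsValid.measurable_env (hI : I.IsValid μ lamS lamD) : Measurable I.env :=
  hI.measurable_B0S.prodMk (hI.measurable_B0D.prodMk
    ((measurable_pi_lambda _ hI.ES_ergodic.measurable).prodMk
      ((measurable_pi_lambda _ hI.ED_ergodic.measurable).prodMk
        (measurable_pi_lambda _ hI.measurable_seed))))

theorem measurableSet_active (hπ : π.IsAdmissible L) (t : ℕ) :
    MeasurableSet {e | 0 < txAt L envInputs π t e ∧ RxAt L envInputs π t e} :=
  (measurableSet_lt measurable_const (measurable_txAt_env hπ t)).inter (measurableSet_rxAt_env hπ t)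

theorem measurable_successRate (hπ : π.IsAdmissible L) (hI : I.IsValid μ lamS lamD) (t : ℕ) :
    Measurable (successRate L I π t) := by
  rw [funext (successRate_eq_indicator (L := L) (I := I) (π := π) t)]
  exact ((Real.measurable_exp.comp (measurable_const.div (measurable_txAt_env hπ t)).neg).indicator
    (measurableSet_active hπ t)).comp hI.measurable_env

theorem integrable_successRate [IsProbabilityMeasure μ] (hπ : π.IsAdmissible L)
    (hI : I.IsValid μ lamS lamD) (t : ℕ) : Integrable (successRate L I π t) μ :=
  Integrable.of_bound (measurable_successRate hπ hI t).aestronglyMeasurable 1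
    (ae_of_all _ fun ω => by
      rw [Real.norm_eq_abs, abs_of_nonneg (successRate_nonneg t ω)]
      exact successRate_le_one t ω)

theorem measureReal_not_success [IsProbabilityMeasure μ] (hπ : π.IsAdmissible L)
    (hI : I.IsValid μ lamS lamD) (t : ℕ) :
    μ.real {ω | ¬ Success L I π t ω} = 1 - ∫ ω, successRate L I π t ω ∂μ := by
  have hind : IndepFun (I.gain t) I.env μ :=
    hI.gain_indep.comp (φ := fun x : ℕ → ℝ => x t) (measurable_pi_apply t) measurable_id
  have hy : Measurable fun e => ((2 : ℝ) ^ L.R - 1) * L.z / txAt L envInputs π t e :=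
    measurable_const.div (measurable_txAt_env hπ t)
  have key := measureReal_exp_ge (hI.measurable_gain t) hI.measurable_env (hI.gain_law t) hind
    (measurableSet_active hπ t) hy (fun w hw => div_nonneg L.outage_pos.le hw.1.le)
  have hset : {ω | Success L I π t ω} = {ω | I.env ω ∈
      {e | 0 < txAt L envInputs π t e ∧ RxAt L envInputs π t e} ∧
        ((2 : ℝ) ^ L.R - 1) * L.z / txAt L envInputs π t (I.env ω) ≤ I.gain t ω} := by
    ext ω
    simp only [Set.mem_ofPred_eq, ← txAt_eq_env, ← rxAt_iff_env, and_assoc]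
    rfl
  have hmeas : MeasurableSet {ω | Success L I π t ω} := by
    rw [hset]
    exact (hI.measurable_env (measurableSet_active hπ t)).inter
      (measurableSet_le (hy.comp hI.measurable_env) (hI.measurable_gain t))
  simp_rw [← successRate_eq_indicator] at key
  rw [← hset] at key
  have : {ω | ¬ Success L I π t ω} = {ω | Success L I π t ω}ᶜ := rfl
  rw [this, measureReal_compl hmeas, key]
  simp

/-- At n = 0 the left side is 0 and the right side is 1, hence the positivity condition. -/
theorem avgOutage_eq [IsProbabilityMeasure μ] (hπ : π.IsAdmissible L)
    (hI : I.IsValid μ lamS lamD) {n : ℕ} (hn : 0 < n) : avgOutage L I μ π n =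
      1 - ∫ ω, (1 / (n : ℝ)) * ∑ t ∈ Finset.range n, successRate L I π t ω ∂μ := by
  have : (n : ℝ) ≠ 0 := by positivity
  unfold avgOutage
  rw [integral_const_mul, integral_finsetSum _ fun t _ => integrable_successRate hπ hI t]
  simp_rw [measureReal_not_success hπ hI]
  rw [Finset.sum_sub_distrib]
  simp
  field_simp

end Rate

/-! ### Upper bounds on expected averages -/

section Average

variable {Ω : Type*} [MeasurableSpace Ω] {μ : Measure Ω} [IsProbabilityMeasure μ]

theorem integrable_min_one_div {Z : Ω → ℝ} (hZ : Measurable Z) (hZ0 : ∀ ω, 0 ≤ Z ω) (n : ℕ) :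
    Integrable (fun ω => min 1 (Z ω / n)) μ :=
  Integrable.of_bound (measurable_const.min (hZ.div_const _)).aestronglyMeasurable 1
    (ae_of_all _ fun ω => by
      rw [Real.norm_eq_abs, abs_of_nonneg
        (le_min zero_le_one (div_nonneg (hZ0 ω) (Nat.cast_nonneg n)))]
      exact min_le_left _ _)

/-- The initial battery levels may have infinite mean; truncation at 1 supplies the domination. -/
theorem tendsto_integral_min_one_div {Z : Ω → ℝ} (hZ : Measurable Z) (hZ0 : ∀ ω, 0 ≤ Z ω) :
    Tendsto (fun n : ℕ => ∫ ω, min 1 (Z ω / n) ∂μ) atTop (𝓝 0) := by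
  have h : Tendsto (fun n : ℕ => ∫ ω, min 1 (Z ω / n) ∂μ) atTop (𝓝 (∫ _, (0 : ℝ) ∂μ)) := by
    refine tendsto_integral_of_dominated_convergence (fun _ => 1)
      (fun n => (integrable_min_one_div hZ hZ0 n).aestronglyMeasurable) (integrable_const 1)
      (fun n => ae_of_all _ fun ω => ?_) (ae_of_all _ fun ω => ?_)
    · rw [Real.norm_eq_abs, abs_of_nonneg
        (le_min zero_le_one (div_nonneg (hZ0 ω) (Nat.cast_nonneg n)))]
      exact min_le_left _ _
    · have h1 : Tendsto (fun n : ℕ => min 1 (Z ω / n)) atTop (𝓝 (min 1 0)) :=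
        tendsto_const_nhds.min (tendsto_const_div_atTop_nhds_zero_nat (Z ω))
      simpa using h1
  simpa using h

/-- If `n f n ≤ Z + Y n` with `f n ≤ 1` and `Y n` of mean `n κ`, then the mean of `f n` is
asymptotically at most `κ`, even if `Z` is not integrable. -/
theorem eventually_integral_le {Z : Ω → ℝ} (hZ : Measurable Z) (hZ0 : ∀ ω, 0 ≤ Z ω)
    {f Y : ℕ → Ω → ℝ} {κ : ℝ} (hf : ∀ n, Integrable (f n) μ) (hf1 : ∀ n ω, f n ω ≤ 1)
    (hY : ∀ n, Integrable (Y n) μ) (hY0 : ∀ n ω, 0 ≤ Y n ω) (hYm : ∀ n : ℕ, ∫ ω, Y n ω ∂μ = n * κ)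
    (hle : ∀ n ω, n * f n ω ≤ Z ω + Y n ω) {ε : ℝ} (hε : 0 < ε) :
    ∀ᶠ n in atTop, ∫ ω, f n ω ∂μ ≤ κ + ε := by
  filter_upwards [(tendsto_integral_min_one_div (μ := μ) hZ hZ0).eventually_lt_const hε,
    eventually_gt_atTop 0] with n hn hn0
  have hnR : (0 : ℝ) < n := by exact_mod_cast hn0
  have hm := integrable_min_one_div (μ := μ) hZ hZ0 n
  calc ∫ ω, f n ω ∂μ ≤ ∫ ω, (min 1 (Z ω / n) + Y n ω / n) ∂μ := by
        -- Since f ≤ 1 and Y ≥ 0, the bound f ≤ Z/n + Y/n survives truncating Z/n at 1.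
        refine integral_mono (hf n) (hm.add ((hY n).div_const _)) fun ω => ?_
        have hq : 0 ≤ Y n ω / n := div_nonneg (hY0 n ω) hnR.le
        simp only
        rw [← min_add_add_right, le_min_iff, ← add_div, le_div_iff₀ hnR, mul_comm]
        exact ⟨by linarith [hf1 n ω], hle n ω⟩
    _ = ∫ ω, min 1 (Z ω / n) ∂μ + κ := by
        rw [integral_add hm ((hY n).div_const _), integral_div, hYm]
        field_simp
    _ ≤ κ + ε := by linarith

end Average

section Sums

variable {Ω : Type*} [MeasurableSpace Ω] {μ : Measure Ω} {L : Params} {I : Inputs Ω} {π : Policy}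
  {lamS lamD : ℝ}

theorem sum_consumption_le (hπ : π.IsAdmissible L) (hI : I.IsValid μ lamS lamD) (n : ℕ) (ω : Ω) :
    ∑ t ∈ Finset.range n, L.consumption (txAt L I π t ω)
      ≤ I.B0S ω + ∑ t ∈ Finset.range n, I.ES t ω := by
  have := (battery_nonneg hπ hI.B0S_nonneg hI.B0D_nonneg hI.ES_nonneg hI.ED_nonneg n ω).1
  rw [battery_fst_eq] at this
  linarith

open Classical in
theorem sum_rxAt_le (hπ : π.IsAdmissible L) (hI : I.IsValid μ lamS lamD) (n : ℕ) (ω : Ω) :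
    ∑ t ∈ Finset.range n, (if RxAt L I π t ω then (1 : ℝ) else 0)
      ≤ I.B0D ω / L.PD + (∑ t ∈ Finset.range n, I.ED t ω) / L.PD := by
  have := (battery_nonneg hπ hI.B0S_nonneg hI.B0D_nonneg hI.ES_nonneg hI.ED_nonneg n ω).2
  rw [battery_snd_eq] at this
  rw [← add_div, le_div_iff₀ L.PD_pos]
  linarith

theorem integral_sum_ES (hI : I.IsValid μ lamS lamD) (n : ℕ) :
    ∫ ω, ∑ t ∈ Finset.range n, I.ES t ω ∂μ = n * lamS := by
  rw [integral_finsetSum _ fun t _ => hI.ES_integrable t]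
  simp [hI.ES_mean]

theorem integral_sum_ED (hI : I.IsValid μ lamS lamD) (n : ℕ) :
    ∫ ω, ∑ t ∈ Finset.range n, I.ED t ω ∂μ = n * lamD := by
  rw [integral_finsetSum _ fun t _ => hI.ED_integrable t]
  simp [hI.ED_mean]

open Classical in
/-- Linear bound on the number of successes in terms of the energy spent. -/
theorem successRate_le (hπ : π.IsAdmissible L) (hI : I.IsValid μ lamS lamD) {u w : ℝ} (hu : 0 ≤ u)
    (hw : 0 ≤ w) (hdual : ∀ p, L.PCS < p → Real.exp (-(L.c / (p - L.PCS))) ≤ u * p + w) (t : ℕ)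
    (ω : Ω) : successRate L I π t ω
      ≤ u * L.consumption (txAt L I π t ω) + w * (if RxAt L I π t ω then 1 else 0) := by
  have hb := battery_nonneg hπ hI.B0S_nonneg hI.B0D_nonneg hI.ES_nonneg hI.ED_nonneg t ω
  have hx : 0 ≤ txAt L I π t ω := hπ.tx_nonneg _ _ _ hb.1 hb.2
  unfold successRate
  split_ifs with h1 h2 h2
  · have hα : 0 < 1 + L.α := by linarith [L.α_pos]
    have hp : L.consumption (txAt L I π t ω) = (1 + L.α) * txAt L I π t ω + L.PCS := by
      rw [Params.consumption, if_pos h1.1]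
    have hlt : L.PCS < L.consumption (txAt L I π t ω) := by
      rw [hp]
      linarith [mul_pos hα h1.1]
    have htx : L.txPower (L.consumption (txAt L I π t ω)) = txAt L I π t ω := by
      rw [Params.txPower, hp]
      field_simp
      ring
    have h := hdual _ hlt
    rw [← L.outage_div_txPower, htx] at h
    linarith
  · exact absurd h1.2 h2
  · have := L.consumption_nonneg hx
    positivity
  · have := L.consumption_nonneg hx
    positivity

variable [IsProbabilityMeasure μ]

/-- Weak duality: the expected success frequency of any policy. -/
theorem eventually_integral_successRate_le (hπ : π.IsAdmissible L) (hI : I.IsValid μ lamS lamD)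
    {u w : ℝ} (hu : 0 ≤ u) (hw : 0 ≤ w)
    (hdual : ∀ p, L.PCS < p → Real.exp (-(L.c / (p - L.PCS))) ≤ u * p + w) {ε : ℝ} (hε : 0 < ε) :
    ∀ᶠ n : ℕ in atTop, ∫ ω, (1 / (n : ℝ)) * ∑ t ∈ Finset.range n, successRate L I π t ω ∂μ
      ≤ u * lamS + w * min 1 (lamD / L.PD) + ε := by
  classical
  have hPD := L.PD_pos
  have hf : ∀ n : ℕ, Integrable
      (fun ω => (1 / (n : ℝ)) * ∑ t ∈ Finset.range n, successRate L I π t ω) μ := fun n =>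
    (integrable_finsetSum _ fun t _ => integrable_successRate hπ hI t).const_mul _
  have hf1 : ∀ (n : ℕ) ω, (1 / (n : ℝ)) * ∑ t ∈ Finset.range n, successRate L I π t ω ≤ 1 := by
    intro n ω
    rw [one_div_mul_eq_div]
    refine div_le_one_of_le₀ ?_ n.cast_nonneg
    calc _ ≤ ∑ t ∈ Finset.range n, (1 : ℝ) :=
          Finset.sum_le_sum fun t _ => successRate_le_one t ω
      _ = n := by simp
  have hsum : ∀ (n : ℕ) ω, n * ((1 / (n : ℝ)) * ∑ t ∈ Finset.range n, successRate L I π t ω)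
      ≤ u * (I.B0S ω + ∑ t ∈ Finset.range n, I.ES t ω)
        + w * ∑ t ∈ Finset.range n, (if RxAt L I π t ω then 1 else 0) := by
    intro n ω
    have h1 : n * ((1 / (n : ℝ)) * ∑ t ∈ Finset.range n, successRate L I π t ω)
        = ∑ t ∈ Finset.range n, successRate L I π t ω := by
      rcases Nat.eq_zero_or_pos n with rfl | hn
      · simp
      · have : (n : ℝ) ≠ 0 := by positivity
        field_simp
    rw [h1]
    calc _ ≤ ∑ t ∈ Finset.range n, (u * L.consumption (txAt L I π t ω)
          + w * (if RxAt L I π t ω then 1 else 0)) :=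
          Finset.sum_le_sum fun t _ => successRate_le hπ hI hu hw hdual t ω
      _ = u * ∑ t ∈ Finset.range n, L.consumption (txAt L I π t ω)
          + w * ∑ t ∈ Finset.range n, (if RxAt L I π t ω then 1 else 0) := by
          rw [Finset.sum_add_distrib, Finset.mul_sum, Finset.mul_sum]
      _ ≤ _ := by
          have := mul_le_mul_of_nonneg_left (sum_consumption_le hπ hI n ω) hu
          linarith
  have hiS : ∀ n : ℕ, Integrable (fun ω => ∑ t ∈ Finset.range n, I.ES t ω) μ := fun n =>
    integrable_finsetSum _ fun t _ => hI.ES_integrable t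
  have hiD : ∀ n : ℕ, Integrable (fun ω => ∑ t ∈ Finset.range n, I.ED t ω) μ := fun n =>
    integrable_finsetSum _ fun t _ => hI.ED_integrable t
  have hS0 : ∀ (n : ℕ) ω, 0 ≤ ∑ t ∈ Finset.range n, I.ES t ω := fun n ω =>
    Finset.sum_nonneg fun t _ => hI.ES_nonneg t ω
  have hD0 : ∀ (n : ℕ) ω, 0 ≤ ∑ t ∈ Finset.range n, I.ED t ω := fun n ω =>
    Finset.sum_nonneg fun t _ => hI.ED_nonneg t ω
  -- The activity of `D` is bounded by the number of slots or by its energy, whichever is scarcer on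
  -- average; this produces the minimum.
  rcases le_total 1 (lamD / L.PD) with hm | hm
  · rw [min_eq_left hm]
    refine eventually_integral_le (Z := fun ω => u * I.B0S ω)
      (Y := fun n ω => u * ∑ t ∈ Finset.range n, I.ES t ω + w * n)
      (hI.measurable_B0S.const_mul u) (fun ω => mul_nonneg hu (hI.B0S_nonneg ω)) hf hf1
      (fun n => ((hiS n).const_mul u).add (integrable_const _))
      (fun n ω => by have := hS0 n ω; positivity) (fun n => ?_) (fun n ω => ?_) hε
    · rw [integral_add ((hiS n).const_mul u) (integrable_const _), integral_const_mul,
        integral_sum_ES hI]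
      simp
      ring
    · refine (hsum n ω).trans ?_
      have h2 : ∑ t ∈ Finset.range n, (if RxAt L I π t ω then (1 : ℝ) else 0) ≤ n := by
        calc _ ≤ ∑ t ∈ Finset.range n, (1 : ℝ) :=
              Finset.sum_le_sum fun t _ => by split_ifs <;> norm_num
          _ = n := by simp
      linarith [mul_le_mul_of_nonneg_left h2 hw]
  · rw [min_eq_right hm]
    refine eventually_integral_le (Z := fun ω => u * I.B0S ω + w * (I.B0D ω / L.PD))
      (Y := fun n ω => u * ∑ t ∈ Finset.range n, I.ES t ω
        + w * ((∑ t ∈ Finset.range n, I.ED t ω) / L.PD))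
      ((hI.measurable_B0S.const_mul u).add ((hI.measurable_B0D.div_const _).const_mul w))
      (fun ω => by have := hI.B0S_nonneg ω; have := hI.B0D_nonneg ω; positivity) hf hf1
      (fun n => ((hiS n).const_mul u).add (((hiD n).div_const _).const_mul w))
      (fun n ω => by have := hS0 n ω; have := hD0 n ω; positivity) (fun n => ?_)
      (fun n ω => ?_) hε
    · rw [integral_add ((hiS n).const_mul u) (((hiD n).div_const _).const_mul w),
        integral_const_mul, integral_const_mul, integral_div, integral_sum_ES hI,
        integral_sum_ED hI]
      ring
    · refine (hsum n ω).trans ?_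
      linarith [mul_le_mul_of_nonneg_left (sum_rxAt_le hπ hI n ω) hw]

theorem le_liminf_avgOutage (hπ : π.IsAdmissible L) (hI : I.IsValid μ lamS lamD)
    {u w : ℝ} (hu : 0 ≤ u) (hw : 0 ≤ w)
    (hdual : ∀ p, L.PCS < p → Real.exp (-(L.c / (p - L.PCS))) ≤ u * p + w) :
    1 - (u * lamS + w * min 1 (lamD / L.PD)) ≤ liminf (avgOutage L I μ π) atTop := by
  refine le_of_forall_pos_le_add fun ε hε => ?_
  rw [← sub_le_iff_le_add]
  -- A real `liminf` can be bounded below this way only if the sequence is not eventually above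
  -- every bound; outage averages are at most 1.
  have hbdd : IsBoundedUnder (· ≤ ·) atTop (avgOutage L I μ π) := by
    refine isBoundedUnder_of_eventually_le (a := 1) ?_
    filter_upwards [eventually_gt_atTop 0] with n hn
    rw [avgOutage_eq hπ hI hn, sub_le_self_iff]
    exact integral_nonneg fun ω => mul_nonneg (by positivity)
      (Finset.sum_nonneg fun t _ => successRate_nonneg t ω)
  refine le_liminf_of_le hbdd.isCoboundedUnder_ge ?_
  filter_upwards [eventually_gt_atTop 0,
    eventually_integral_successRate_le hπ hI hu hw hdual hε] with n hn h
  rw [avgOutage_eq hπ hI hn]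
  linarith

end Sums

/-! ### The joint threshold policy -/

section Threshold

variable {L : Params} {PS : ℝ}

theorem jointThreshold_isAdmissible (hPS : L.PCS < PS) : (jointThreshold L PS).IsAdmissible L := by
  classical
  have hm : MeasurableSet {x : ℝ × ℝ × ℝ | PS ≤ x.1 ∧ L.PD ≤ x.2.1} :=
    (measurableSet_le measurable_const measurable_fst).inter
      (measurableSet_le measurable_const measurable_snd.fst)
  refine ⟨?_, hm, ?_, ?_, ?_⟩
  · unfold jointThreshold
    exact Measurable.ite hm measurable_const measurable_const
  · intro bS bD v _ _
    unfold jointThreshold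
    dsimp only
    split_ifs
    · exact (L.txPower_pos hPS).le
    · exact le_rfl
  · intro bS bD v h _
    unfold jointThreshold
    dsimp only
    split_ifs with h'
    · rw [L.consumption_txPower hPS]
      exact h'.1
    · simpa [Params.consumption] using h
  · intro bS bD v _ _ h
    exact h.2

variable {Ω : Type*} {I : Inputs Ω}

open Classical in
/-- The number of active slots of the joint threshold policy among the first `n`. -/
noncomputable def activeCount (L : Params) (I : Inputs Ω) (PS : ℝ) (n : ℕ) (ω : Ω) : ℝ :=
  ∑ t ∈ Finset.range n, if RxAt L I (jointThreshold L PS) t ω then 1 else 0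

theorem activeCount_nonneg (n : ℕ) (ω : Ω) : 0 ≤ activeCount L I PS n ω :=
  Finset.sum_nonneg fun t _ => by split_ifs <;> norm_num

theorem activeCount_le (n : ℕ) (ω : Ω) : activeCount L I PS n ω ≤ n := by
  classical
  calc _ ≤ ∑ t ∈ Finset.range n, (1 : ℝ) :=
        Finset.sum_le_sum fun t _ => by split_ifs <;> norm_num
    _ = n := by simp

open Classical in
theorem txAt_jointThreshold (t : ℕ) (ω : Ω) : txAt L I (jointThreshold L PS) t ω =
    if RxAt L I (jointThreshold L PS) t ω then L.txPower PS else 0 := by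
  by_cases h : RxAt L I (jointThreshold L PS) t ω
  · rw [if_pos h]
    exact if_pos h
  · rw [if_neg h]
    exact if_neg h

theorem sum_successRate_jointThreshold (hPS : L.PCS < PS) (n : ℕ) (ω : Ω) :
    ∑ t ∈ Finset.range n, successRate L I (jointThreshold L PS) t ω =
      Real.exp (-(((2 : ℝ) ^ L.R - 1) * L.z / L.txPower PS)) * activeCount L I PS n ω := by
  classical
  have hx := L.txPower_pos hPS
  rw [activeCount, Finset.mul_sum]
  refine Finset.sum_congr rfl fun t _ => ?_
  rw [successRate, txAt_jointThreshold]
  by_cases h : RxAt L I (jointThreshold L PS) t ω <;> simp [h, hx]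

theorem sum_consumption_jointThreshold (hPS : L.PCS < PS) (n : ℕ) (ω : Ω) :
    ∑ t ∈ Finset.range n, L.consumption (txAt L I (jointThreshold L PS) t ω) =
      PS * activeCount L I PS n ω := by
  classical
  rw [activeCount, Finset.mul_sum]
  refine Finset.sum_congr rfl fun t _ => ?_
  rw [txAt_jointThreshold]
  by_cases h : RxAt L I (jointThreshold L PS) t ω
  · simp [h, L.consumption_txPower hPS]
  · simp [h, Params.consumption]

/-- Pathwise lower bound: a slot is idle only if one of the batteries is nearly empty. -/
theorem exists_le_activeCount (hPS : L.PCS < PS) {ω : Ω} (h0S : 0 ≤ I.B0S ω) (h0D : 0 ≤ I.B0D ω)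
    {r : ℝ} (hr : r ≤ 1) {C D : ℝ}
    (hC : ∀ n : ℕ, r * PS * n - C ≤ ∑ t ∈ Finset.range n, I.ES t ω)
    (hD : ∀ n : ℕ, r * L.PD * n - D ≤ ∑ t ∈ Finset.range n, I.ED t ω) :
    ∃ K : ℝ, ∀ n : ℕ, r * n - K ≤ activeCount L I PS n ω := by
  classical
  have hPD := L.PD_pos
  have hPS0 : 0 < PS := L.PCS_nonneg.trans_lt hPS
  have hCn : 0 ≤ |C| / PS := by positivity
  have hDn : 0 ≤ |D| / L.PD := by positivity
  -- The first two terms cover a shortage in either battery, one 1 is the energy of a single slot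
  -- that an insufficient battery may still hold, and the other is the loss in `le_counter`.
  refine ⟨|C| / PS + |D| / L.PD + 1 + 1, fun n => ?_⟩
  refine le_counter (N := fun n => activeCount L I PS n ω) hr (by linarith)
    (by simp [activeCount]) (fun t => ?_) n
  have hsucc : activeCount L I PS (t + 1) ω = activeCount L I PS t ω +
      if RxAt L I (jointThreshold L PS) t ω then 1 else 0 := Finset.sum_range_succ _ _
  simp only [hsucc]
  by_cases h : RxAt L I (jointThreshold L PS) t ω
  · left
    rw [if_pos h]
  · right
    rw [if_neg h]
    refine ⟨add_zero _, ?_⟩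
    have h' : ¬ (PS ≤ (battery L I (jointThreshold L PS) t ω).1 ∧
      L.PD ≤ (battery L I (jointThreshold L PS) t ω).2) := h
    rw [not_and_or, not_le, not_le, battery_fst_eq, battery_snd_eq,
      sum_consumption_jointThreshold hPS] at h'
    change _ ∨ _ - L.PD * activeCount L I PS t ω < _ at h'
    rcases h' with h' | h'
    · have e : r * t - (|C| / PS + 1) ≤ activeCount L I PS t ω := by
        refine le_of_mul_le_mul_left ?_ hPS0
        have : PS * (|C| / PS) = |C| := by field_simp
        linarith [hC t, le_abs_self C]
      linarith
    · have e : r * t - (|D| / L.PD + 1) ≤ activeCount L I PS t ω := by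
        refine le_of_mul_le_mul_left ?_ hPD
        have : L.PD * (|D| / L.PD) = |D| := by field_simp
        linarith [hD t, le_abs_self D]
      linarith

theorem activeCount_div_le_one (n : ℕ) (ω : Ω) : activeCount L I PS n ω / n ≤ 1 :=
  div_le_one_of_le₀ (activeCount_le n ω) n.cast_nonneg

variable [MeasurableSpace Ω] {μ : Measure Ω} {lamS lamD : ℝ}

theorem measurable_activeCount (hPS : L.PCS < PS) (hI : I.IsValid μ lamS lamD) (n : ℕ) :
    Measurable (activeCount L I PS n) := by
  classical
  refine Finset.measurable_sum _ fun t _ => Measurable.ite ?_ measurable_const measurable_const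
  exact measurableSet_rxAt (jointThreshold_isAdmissible hPS) hI.measurable_B0S hI.measurable_B0D
    hI.ES_ergodic.measurable hI.ED_ergodic.measurable hI.measurable_seed t

variable [IsProbabilityMeasure μ]

theorem integrable_activeCount_div (hPS : L.PCS < PS) (hI : I.IsValid μ lamS lamD) (n : ℕ) :
    Integrable (fun ω => activeCount L I PS n ω / n) μ :=
  Integrable.of_bound ((measurable_activeCount hPS hI n).div_const _).aestronglyMeasurable 1
    (ae_of_all _ fun ω => by
      rw [Real.norm_eq_abs, abs_of_nonneg (div_nonneg (activeCount_nonneg n ω) n.cast_nonneg)]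
      exact activeCount_div_le_one n ω)

/-- For r strictly between a and the minimum, the shortfall of the active fraction below r is almost
surely O(1/n) with a random constant. It is bounded by 1, so its mean tends to 0. -/
theorem eventually_lt_integral_activeCount (hPS : L.PCS < PS) (hI : I.IsValid μ lamS lamD) {a : ℝ}
    (ha : a < min 1 (min (lamS / PS) (lamD / L.PD))) :
    ∀ᶠ n : ℕ in atTop, a < ∫ ω, activeCount L I PS n ω / n ∂μ := by
  obtain ⟨r, har, hr⟩ := exists_between ha
  have hPS0 : 0 < PS := L.PCS_nonneg.trans_lt hPS
  obtain ⟨hr1, hrS, hrD⟩ : r < 1 ∧ r < lamS / PS ∧ r < lamD / L.PD := by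
    simpa only [lt_min_iff] using hr
  rw [lt_div_iff₀ hPS0] at hrS
  rw [lt_div_iff₀ L.PD_pos] at hrD
  have hmeas : ∀ n : ℕ, Measurable fun ω => max 0 (r - activeCount L I PS n ω / n) := fun n =>
    measurable_const.max (measurable_const.sub ((measurable_activeCount hPS hI n).div_const _))
  have hbound : ∀ (n : ℕ) ω, ‖max 0 (r - activeCount L I PS n ω / n)‖ ≤ 1 := by
    intro n ω
    rw [Real.norm_eq_abs, abs_of_nonneg (le_max_left _ _)]
    have : 0 ≤ activeCount L I PS n ω / n := div_nonneg (activeCount_nonneg n ω) n.cast_nonneg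
    exact max_le zero_le_one (by linarith)
  have hlim : Tendsto (fun n : ℕ => ∫ ω, max 0 (r - activeCount L I PS n ω / n) ∂μ) atTop
      (𝓝 (∫ _, (0 : ℝ) ∂μ)) := by
    refine tendsto_integral_of_dominated_convergence (fun _ => 1)
      (fun n => (hmeas n).aestronglyMeasurable) (integrable_const 1)
      (fun n => ae_of_all _ (hbound n)) ?_
    filter_upwards [hI.ES_ergodic.ae_exists_le_sum (hI.ES_integrable 0)
        (by rw [hI.ES_mean]; exact hrS),
      hI.ED_ergodic.ae_exists_le_sum (hI.ED_integrable 0) (by rw [hI.ED_mean]; exact hrD)]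
      with ω ⟨C, hC⟩ ⟨D, hD⟩
    obtain ⟨K, hK⟩ :=
      exists_le_activeCount hPS (hI.B0S_nonneg ω) (hI.B0D_nonneg ω) hr1.le hC hD
    have h1 : Tendsto (fun n : ℕ => max 0 (K / n)) atTop (𝓝 (max 0 0)) :=
      tendsto_const_nhds.max (tendsto_const_div_atTop_nhds_zero_nat K)
    rw [max_self] at h1
    refine tendsto_of_tendsto_of_tendsto_of_le_of_le' tendsto_const_nhds h1
      (Eventually.of_forall fun n => le_max_left _ _) ?_
    filter_upwards [eventually_gt_atTop 0] with n hn
    have hnR : (0 : ℝ) < n := by exact_mod_cast hn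
    refine max_le_max le_rfl ?_
    rw [sub_le_iff_le_add, ← add_div, le_div_iff₀ hnR]
    linarith [hK n]
  rw [integral_zero] at hlim
  filter_upwards [hlim.eventually_lt_const (sub_pos.2 har)] with n hn
  have hd : Integrable (fun ω => max 0 (r - activeCount L I PS n ω / n)) μ :=
    Integrable.of_bound (hmeas n).aestronglyMeasurable 1 (ae_of_all _ (hbound n))
  have hsum : r ≤ ∫ ω, activeCount L I PS n ω / n ∂μ
      + ∫ ω, max 0 (r - activeCount L I PS n ω / n) ∂μ := by
    rw [← integral_add (integrable_activeCount_div hPS hI n) hd]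
    calc r = ∫ _, r ∂μ := by simp
      _ ≤ _ := integral_mono (integrable_const r) ((integrable_activeCount_div hPS hI n).add hd)
        fun ω => by
          have := le_max_right 0 (r - activeCount L I PS n ω / n)
          rw [Pi.add_apply]
          linarith
  linarith

/-- Each term of the minimum is a separate budget: slots, energy of `S`, energy of `D`. -/
theorem eventually_integral_activeCount_le (hPS : L.PCS < PS) (hI : I.IsValid μ lamS lamD) {ε : ℝ}
    (hε : 0 < ε) : ∀ᶠ n : ℕ in atTop, ∫ ω, activeCount L I PS n ω / n ∂μ
      ≤ min 1 (min (lamS / PS) (lamD / L.PD)) + ε := by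
  have hPS0 : 0 < PS := L.PCS_nonneg.trans_lt hPS
  have hPD := L.PD_pos
  have hπ := jointThreshold_isAdmissible hPS
  have hmul : ∀ (n : ℕ) ω, n * (activeCount L I PS n ω / n) = activeCount L I PS n ω := by
    intro n ω
    rcases Nat.eq_zero_or_pos n with rfl | hn
    · simp [activeCount]
    · have : (n : ℝ) ≠ 0 := by positivity
      field_simp
  have h1 : ∀ n : ℕ, ∫ ω, activeCount L I PS n ω / n ∂μ ≤ 1 := fun n => by
    calc _ ≤ ∫ _, (1 : ℝ) ∂μ := integral_mono (integrable_activeCount_div hPS hI n)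
          (integrable_const 1) (activeCount_div_le_one n)
      _ = 1 := by simp
  have hS := eventually_integral_le (μ := μ) (Z := fun ω => I.B0S ω / PS)
    (f := fun n ω => activeCount L I PS n ω / n)
    (Y := fun n ω => (∑ t ∈ Finset.range n, I.ES t ω) / PS) (κ := lamS / PS)
    (hI.measurable_B0S.div_const _) (fun ω => div_nonneg (hI.B0S_nonneg ω) hPS0.le)
    (integrable_activeCount_div hPS hI) activeCount_div_le_one
    (fun n => (integrable_finsetSum _ fun t _ => hI.ES_integrable t).div_const _)
    (fun n ω => div_nonneg (Finset.sum_nonneg fun t _ => hI.ES_nonneg t ω) hPS0.le)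
    (fun n => by rw [integral_div, integral_sum_ES hI]; ring)
    (fun n ω => by
      have := sum_consumption_le hπ hI n ω
      rw [sum_consumption_jointThreshold hPS] at this
      rw [hmul, ← add_div, le_div_iff₀ hPS0]
      linarith) hε
  have hD := eventually_integral_le (μ := μ) (Z := fun ω => I.B0D ω / L.PD)
    (f := fun n ω => activeCount L I PS n ω / n)
    (Y := fun n ω => (∑ t ∈ Finset.range n, I.ED t ω) / L.PD) (κ := lamD / L.PD)
    (hI.measurable_B0D.div_const _) (fun ω => div_nonneg (hI.B0D_nonneg ω) hPD.le)
    (integrable_activeCount_div hPS hI) activeCount_div_le_one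
    (fun n => (integrable_finsetSum _ fun t _ => hI.ED_integrable t).div_const _)
    (fun n ω => div_nonneg (Finset.sum_nonneg fun t _ => hI.ED_nonneg t ω) hPD.le)
    (fun n => by rw [integral_div, integral_sum_ED hI]; ring)
    (fun n ω => by
      rw [hmul]
      exact sum_rxAt_le hπ hI n ω) hε
  filter_upwards [hS, hD] with n hnS hnD
  rw [← min_add_add_right, ← min_add_add_right]
  exact le_min (by linarith [h1 n]) (le_min hnS hnD)

theorem tendsto_avgOutage_jointThreshold (hPS : L.PCS < PS) (hI : I.IsValid μ lamS lamD) :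
    Tendsto (avgOutage L I μ (jointThreshold L PS)) atTop
      (𝓝 (L.thresholdOutage lamS lamD PS)) := by
  have hlim : Tendsto (fun n : ℕ => ∫ ω, activeCount L I PS n ω / n ∂μ) atTop
      (𝓝 (min 1 (min (lamS / PS) (lamD / L.PD)))) := by
    refine tendsto_order.2 ⟨fun a ha => eventually_lt_integral_activeCount hPS hI ha,
      fun b hb => ?_⟩
    filter_upwards [eventually_integral_activeCount_le hPS hI (half_pos (sub_pos.2 hb))] with n hn
    linarith
  refine (tendsto_const_nhds.sub (hlim.const_mul _)).congr' ?_
  filter_upwards [eventually_gt_atTop 0] with n hn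
  rw [avgOutage_eq (jointThreshold_isAdmissible hPS) hI hn, ← integral_const_mul]
  congr 2
  ext ω
  rw [sum_successRate_jointThreshold hPS]
  ring

end Threshold

/-- Weak duality for the active fraction m: m P_S ≤ λ_S and m ≤ min(1, λ_D/P_D). Because m > 0, the
strict tangent inequality stays strict after multiplication by m. -/
theorem thresholdOutage_lt {L : Params} {lamS lamD PS u w : ℝ} (hS : 0 < lamS) (hD : 0 < lamD)
    (hPS : L.PCS < PS) (hu : 0 ≤ u) (hw : 0 ≤ w)
    (h : Real.exp (-(L.c / (PS - L.PCS))) < u * PS + w) :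
    1 - (u * lamS + w * min 1 (lamD / L.PD)) < L.thresholdOutage lamS lamD PS := by
  have hPS0 : 0 < PS := L.PCS_nonneg.trans_lt hPS
  have hPD := L.PD_pos
  unfold Params.thresholdOutage
  rw [L.outage_div_txPower]
  set m := min 1 (min (lamS / PS) (lamD / L.PD))
  have hm : 0 < m := lt_min one_pos (lt_min (by positivity) (by positivity))
  have h1 : m * PS ≤ lamS := by
    rw [← le_div_iff₀ hPS0]
    exact (min_le_right _ _).trans (min_le_left _ _)
  have h2 : m ≤ min 1 (lamD / L.PD) :=
    le_min (min_le_left _ _) ((min_le_right _ _).trans (min_le_right _ _))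
  linarith [mul_lt_mul_of_pos_right h hm, mul_le_mul_of_nonneg_left h1 hu,
    mul_le_mul_of_nonneg_left h2 hw]

end EHLink

theorem theorem3 {Ω : Type*} [MeasurableSpace Ω] (μ : Measure Ω) [IsProbabilityMeasure μ]
    (L : EHLink.Params) (lamS lamD : ℝ) (hS : 0 < lamS) (hD : 0 < lamD)
    (I : EHLink.Inputs Ω) (hI : I.IsValid μ lamS lamD) :
    -- the threshold is usable, and the joint threshold policy is an admissible stationary policy
    L.PCS < L.optThreshold lamS lamD ∧
    (EHLink.jointThreshold L (L.optThreshold lamS lamD)).IsAdmissible L ∧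
    -- its long-run outage probability exists; the value does not depend on the joint law of arrivals
    Tendsto (EHLink.avgOutage L I μ (EHLink.jointThreshold L (L.optThreshold lamS lamD))) atTop
      (𝓝 (L.thresholdOutage lamS lamD (L.optThreshold lamS lamD))) ∧
    -- no admissible stationary policy does better
    (∀ π : EHLink.Policy, π.IsAdmissible L →
      L.thresholdOutage lamS lamD (L.optThreshold lamS lamD) ≤
        liminf (EHLink.avgOutage L I μ π) atTop) ∧
    -- every other threshold is strictly worse
    (∀ PS : ℝ, L.PCS < PS → PS ≠ L.optThreshold lamS lamD →
      ∃ p : ℝ, Tendsto (EHLink.avgOutage L I μ (EHLink.jointThreshold L PS)) atTop (𝓝 p) ∧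
        L.thresholdOutage lamS lamD (L.optThreshold lamS lamD) < p) := by
  -- The same dual pair certifies optimality among all policies and strict loss at every other
  -- threshold.
  obtain ⟨u, w, hu, hw, hle, hlt, hval⟩ := L.exists_dual hS hD
  have hth := L.PCS_lt_optThreshold lamS lamD
  refine ⟨hth, EHLink.jointThreshold_isAdmissible hth,
    EHLink.tendsto_avgOutage_jointThreshold hth hI, fun π hπ => ?_, fun PS hPS hne =>
      ⟨_, EHLink.tendsto_avgOutage_jointThreshold hPS hI, ?_⟩⟩
  · rw [hval]
    exact EHLink.le_liminf_avgOutage hπ hI hu hw hle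
  · rw [hval]
    exact EHLink.thresholdOutage_lt hS hD hPS hu hw (hlt PS hPS hne)
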